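/- Let $n,c\in\mathbb N$. A (tensor product) strategy with $n$-dimensional quantum inputs and $c$ classical outputs consists of Hilbert spaces $\mathcal H_A,\mathcal H_B$, operators $P_{a,ij}\in\mathcal B(\mathcal H_A)$ and $Q_{b,k\ell}\in\mathcal B(\mathcal H_B)$ ($1\le a,b\le c$, $1\le i,j,k,\ell\le n$) such that the block matrices $P_a=(P_{a,ij})_{i,j}\in M_n(\mathcal B(\mathcal H_A))$ and $Q_b=(Q_{b,k\ell})_{k,\ell}\in M_n(\mathcal B(\mathcal H_B))$ are positive with $\sum_{a=1}^c P_a=I$ and $\sum_{b=1}^c Q_b=I$, and a unit vector $\chi\in\mathcal H_A\otimes\mathcal H_B$ (Hilbert space tensor product). Its correlation is the tuple $X=(X^{(a,b)}_{(i,j),(k,\ell)})\in (M_n\otimes M_n)^{c^2}$ with $$X^{(a,b)}_{(i,j),(k,\ell)}=\langle (P_{a,ij}\otimes Q_{b,k\ell})\chi,\chi\rangle .$$ Let $\mathcal Q_{qs}(n,c)$ be the set of correlations of all such strategies, and let $\mathcal Q_q(n,c)$ be the set of correlations of those strategies for which $\mathcal H_A$ and $\mathcal H_B$ are finite-dimensional.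 Let $e_1,\dots,e_n$ be the standard basis of $\mathbb C^n$. For a vector $\varphi=\sum_{j,\ell}\varphi_{j\ell}\,e_j\otimes e_\ell\in\mathbb C^n\otimes\mathbb C^n$ put $$p(a,b|\varphi)=\sum_{i,j,k,\ell}\overline{\varphi_{ik}}\,\varphi_{j\ell}\,X^{(a,b)}_{(i,j),(k,\ell)},$$ which, for the correlation of a strategy, equals $\langle (P_a\otimes Q_b)(\varphi\odot\chi),\varphi\odot\chi\rangle$, where $\varphi\odot\chi$ is $\varphi\otimes\chi$ regarded as a vector of $\mathbb C^n\otimes\mathcal H_A\otimes\mathcal H_B\otimes\mathbb C^n$. For a non-empty $S\subseteq\{1,\dots,n\}$ let $\varphi_S=|S|^{-1/2}\sum_{j\in S}e_j\otimes e_j$. A correlation $X$ is called synchronous if there is a partition $S_1\,\dot\cup\cdots\dot\cup\,S_m$ of $\{1,\dots,n\}$ such that $p(a,b|\varphi_{S_r})=0$ for all $1\le r\le m$ and all $a\ne b$. Write $\mathcal Q_{t}^s(n,c)$ for the set of synchronous elements of $\mathcal Q_t(n,c)$, $t\in\{q,qs\}$. **Theorem.** For all $n,c\in\mathbb N$, we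 have $\mathcal Q_{qs}^s(n,c)=\mathcal Q_q^s(n,c)$. -/

import Mathlib

open scoped TensorProduct InnerProductSpace

universe u v w

namespace QInput

noncomputable section

/-- The Hilbert space tensor product: the completion of the algebraic tensor product with respect to
the inner product `⟪x ⊗ y, x' ⊗ y'⟫ = ⟪x, x'⟫ ⟪y, y'⟫`. -/
abbrev HTensor (H : Type u) (K : Type v)
    [NormedAddCommGroup H] [InnerProductSpace ℂ H]
    [NormedAddCommGroup K] [InnerProductSpace ℂ K] : Type (max u v) :=
  UniformSpace.Completion (H ⊗[ℂ] K)

/-- The bounded operator `S ⊗ T` on the Hilbert space tensor product. -/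
def opTensor {H : Type u} {K : Type v}
    [NormedAddCommGroup H] [InnerProductSpace ℂ H]
    [NormedAddCommGroup K] [InnerProductSpace ℂ K]
    (S : H →L[ℂ] H) (T : K →L[ℂ] K) : HTensor H K →L[ℂ] HTensor H K :=
  (TensorProduct.mapL S T).completion

/-- The bounded operator on `ℂ^ι ⊗ H`, identified with the Hilbert space direct sum of copies of `H`
indexed by `ι`, given by a block matrix `M = (M i j)` of bounded operators on `H`:
`(M x) i = ∑ j, M i j (x j)`. -/
def blockOp {ι : Type w} [Fintype ι] {H : Type u} [NormedAddCommGroup H] [InnerProductSpace ℂ H]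
    (M : Matrix ι ι (H →L[ℂ] H)) :
    PiLp 2 (fun _ : ι => H) →L[ℂ] PiLp 2 (fun _ : ι => H) :=
  (PiLp.continuousLinearEquiv 2 ℂ (fun _ : ι => H)).symm.toContinuousLinearMap ∘L
    ContinuousLinearMap.pi fun i => ∑ j, M i j ∘L PiLp.proj 2 (fun _ : ι => H) j

theorem blockOp_apply {ι : Type w} [Fintype ι] {H : Type u}
    [NormedAddCommGroup H] [InnerProductSpace ℂ H]
    (M : Matrix ι ι (H →L[ℂ] H)) (x : PiLp 2 (fun _ : ι => H)) (i : ι) :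
    blockOp M x i = ∑ j, M i j (x j) := by
  simp [blockOp]

/-- A POVM with `c` outcomes on `ℂ^n ⊗ H`, given by its blocks: each `P a = (P a i j)` is positive
in `M_n(B(H))`, and `∑ a, P a` is the identity of `M_n(B(H))`. -/
structure IsPOVM {n c : ℕ} {H : Type u} [NormedAddCommGroup H] [InnerProductSpace ℂ H]
    (P : Fin c → Matrix (Fin n) (Fin n) (H →L[ℂ] H)) : Prop where
  pos : ∀ a, (blockOp (P a)).IsPositive
  sum_eq_one : ∑ a, P a = 1

/-- A strategy in the tensor product framework with `n`-dimensional quantum inputs, `c` classical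
outputs, and resource spaces `HA` (for Alice) and `HB` (for Bob). The shared state is a unit
vector of the Hilbert space tensor product. -/
structure Strategy (n c : ℕ) (HA : Type u) (HB : Type v)
    [NormedAddCommGroup HA] [InnerProductSpace ℂ HA]
    [NormedAddCommGroup HB] [InnerProductSpace ℂ HB] where
  P : Fin c → Matrix (Fin n) (Fin n) (HA →L[ℂ] HA)
  Q : Fin c → Matrix (Fin n) (Fin n) (HB →L[ℂ] HB)
  χ : HTensor HA HB
  povm_P : IsPOVM P
  povm_Q : IsPOVM Q
  norm_χ : ‖χ‖ = 1

/-- Elements of `(M_n ⊗ M_n)^(c²)`; the entry `X^(a,b)_((i,j),(k,l))` is `X a b (i, j) (k, l)`. -/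
abbrev Corr (n c : ℕ) : Type :=
  Fin c → Fin c → Fin n × Fin n → Fin n × Fin n → ℂ

/-- The correlation of a strategy: `X^(a,b)_((i,j),(k,l)) = ⟨(P_{a,ij} ⊗ Q_{b,kl}) χ, χ⟩`.
(Mathlib's inner product is conjugate linear in its first argument.) -/
def Strategy.correlation {n c : ℕ} {HA : Type u} {HB : Type v}
    [NormedAddCommGroup HA] [InnerProductSpace ℂ HA]
    [NormedAddCommGroup HB] [InnerProductSpace ℂ HB]
    (S : Strategy n c HA HB) : Corr n c :=
  fun a b ij kl => ⟪S.χ, opTensor (S.P a ij.1 ij.2) (S.Q b kl.1 kl.2) S.χ⟫_ℂ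

/-- The quantum spatial correlations: those of strategies on arbitrary Hilbert spaces. -/
def Qqs (n c : ℕ) : Set (Corr n c) :=
  {X | ∃ (HA HB : Type u)
    (_ : NormedAddCommGroup HA) (_ : InnerProductSpace ℂ HA) (_ : CompleteSpace HA)
    (_ : NormedAddCommGroup HB) (_ : InnerProductSpace ℂ HB) (_ : CompleteSpace HB)
    (S : Strategy n c HA HB), S.correlation = X}

/-- The quantum correlations: those of strategies on finite-dimensional Hilbert spaces. -/
def Qq (n c : ℕ) : Set (Corr n c) :=
  {X | ∃ (HA HB : Type u)
    (_ : NormedAddCommGroup HA) (_ : InnerProductSpace ℂ HA) (_ : FiniteDimensional ℂ HA)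
    (_ : NormedAddCommGroup HB) (_ : InnerProductSpace ℂ HB) (_ : FiniteDimensional ℂ HB)
    (S : Strategy n c HA HB), S.correlation = X}

/-- The value `p(a, b | φ)` assigned by a correlation `X` to the outputs `(a, b)` on the input
`φ ∈ ℂ^n ⊗ ℂ^n`, where the coordinate `φ (j, l)` is the coefficient of `e_j ⊗ e_l`. -/
def Corr.prob {n c : ℕ} (X : Corr n c) (φ : EuclideanSpace ℂ (Fin n × Fin n))
    (a b : Fin c) : ℂ :=
  ∑ ik : Fin n × Fin n, ∑ jl : Fin n × Fin n,
    starRingEnd ℂ (φ ik) * φ jl * X a b (ik.1, jl.1) (ik.2, jl.2)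

/-- The vector `φ ⊙ χ` of `ℂ^n ⊗ HA ⊗ HB ⊗ ℂ^n`, the latter space being identified with the direct
sum of copies of `HA ⊗ HB` indexed by pairs of basis vectors of the outer factors. -/
def inputState {n : ℕ} {H : Type u} [NormedAddCommGroup H] [InnerProductSpace ℂ H]
    (φ : EuclideanSpace ℂ (Fin n × Fin n)) (χ : H) : PiLp 2 (fun _ : Fin n × Fin n => H) :=
  WithLp.toLp 2 fun ik => φ ik • χ

/-- The operator `P_a ⊗ Q_b` on `ℂ^n ⊗ HA ⊗ HB ⊗ ℂ^n`. -/
def Strategy.jointOp {n c : ℕ} {HA : Type u} {HB : Type v}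
    [NormedAddCommGroup HA] [InnerProductSpace ℂ HA]
    [NormedAddCommGroup HB] [InnerProductSpace ℂ HB]
    (S : Strategy n c HA HB) (a b : Fin c) :
    PiLp 2 (fun _ : Fin n × Fin n => HTensor HA HB) →L[ℂ]
      PiLp 2 (fun _ : Fin n × Fin n => HTensor HA HB) :=
  blockOp (Matrix.of fun ik jl => opTensor (S.P a ik.1 jl.1) (S.Q b ik.2 jl.2))

/-- For the correlation of a strategy, `p(a, b | φ) = ⟨(P_a ⊗ Q_b)(φ ⊙ χ), φ ⊙ χ⟩`. -/
theorem Strategy.prob_correlation {n c : ℕ} {HA : Type u} {HB : Type v}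
    [NormedAddCommGroup HA] [InnerProductSpace ℂ HA]
    [NormedAddCommGroup HB] [InnerProductSpace ℂ HB]
    (S : Strategy n c HA HB) (φ : EuclideanSpace ℂ (Fin n × Fin n)) (a b : Fin c) :
    Corr.prob S.correlation φ a b =
      ⟪inputState φ S.χ, S.jointOp a b (inputState φ S.χ)⟫_ℂ := by
  simp only [Corr.prob, Strategy.correlation, Strategy.jointOp, inputState, PiLp.inner_apply,
    blockOp_apply, Matrix.of_apply, map_smul, inner_sum, inner_smul_left, inner_smul_right]
  refine Finset.sum_congr rfl fun ik _ => Finset.sum_congr rfl fun jl _ => ?_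
  ring

/-- The maximally entangled Bell state `|S|^(-1/2) ∑_{j ∈ S} e_j ⊗ e_j`. -/
def bellState {n : ℕ} (S : Finset (Fin n)) : EuclideanSpace ℂ (Fin n × Fin n) :=
  ((1 / Real.sqrt (S.card : ℝ) : ℝ) : ℂ) • ∑ j ∈ S, EuclideanSpace.single (j, j) (1 : ℂ)

/-- `X` is synchronous if there is a partition of `[n]` such that, for every block `S` of it,
different outputs have probability zero on the Bell state of `S`. -/
def Corr.IsSynchronous {n c : ℕ} (X : Corr n c) : Prop :=
  ∃ π : Finpartition (Finset.univ : Finset (Fin n)),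
    ∀ S ∈ π.parts, ∀ a b : Fin c, a ≠ b → X.prob (bellState S) a b = 0

/-- The synchronous quantum spatial correlations. -/
def QqsSync (n c : ℕ) : Set (Corr n c) := {X | X ∈ Qqs.{u} n c ∧ X.IsSynchronous}

/-- The synchronous quantum correlations. -/
def QqSync (n c : ℕ) : Set (Corr n c) := {X | X ∈ Qq.{u} n c ∧ X.IsSynchronous}

end

end QInput

/-! View the state `χ` as a conjugate linear operator `T : HA → HB`, `T x = (⟨x| ⊗ 1) χ`; it is
compact, being a norm limit of finite-rank operators. Synchronicity together with `∑ P_a = 1` and `∑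
Q_b = 1` forces `(P_{a,ik} ⊗ 1) χ = (1 ⊗ Q_{a,ki}) χ` (`Strategy.opTensor_one_eq`), that is,
`Q_{a,ik} T = T P_{a,ik}` (`Strategy.apply_contract`). The blocks of a POVM are closed under
adjoints, so all `P_{a,ij}` commute with the compact self-adjoint operator `T† T` and preserve its
eigenspaces `V μ`, which are finite-dimensional for `μ ≠ 0`.

Accordingly `χ` is the sum of its components `χ μ` in `V μ ⊗ HB`, with `χ 0 = 0`. Cross terms
between different eigenspaces vanish, so the correlation is a convergent sum of unnormalized
correlations of the `χ μ`. These lie in a finite-dimensional space, where the sum of a convergent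
series is already a finite combination of its terms with coefficients `d μ ≥ 0`
(`exists_finset_sum_smul_eq_of_hasSum`). Hence `ξ = ∑ √(d μ) χ μ`, a finite sum, has exactly the
same correlation. It lies in `U ⊗ T(U)`, with `U` a finite sum of eigenspaces for nonzero `μ`, and
both factors are invariant; restricting the strategy to them finishes the proof. -/

namespace QInput

noncomputable section

/-! ### Hilbert space tensor products and vectors as compact operators. -/

section Tensor

variable {H : Type u} {K : Type v} [NormedAddCommGroup H] [InnerProductSpace ℂ H]
  [NormedAddCommGroup K] [InnerProductSpace ℂ K]

/-- The elementary tensor `x ⊗ y` in the Hilbert space tensor product, as a bounded bilinear map. -/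
def htmul : H →L[ℂ] K →L[ℂ] HTensor H K :=
  (ContinuousLinearMap.compL ℂ K (H ⊗[ℂ] K) (HTensor H K) UniformSpace.Completion.toComplL) ∘L
    TensorProduct.mkL ℂ H K

theorem htmul_apply (x : H) (y : K) : htmul x y = ((x ⊗ₜ[ℂ] y : H ⊗[ℂ] K) : HTensor H K) := rfl

theorem inner_htmul (x x' : H) (y y' : K) :
    ⟪htmul x y, htmul x' y'⟫_ℂ = ⟪x, x'⟫_ℂ * ⟪y, y'⟫_ℂ := by
  simp [htmul_apply]

theorem opTensor_htmul (S : H →L[ℂ] H) (T : K →L[ℂ] K) (x : H) (y : K) :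
    opTensor S T (htmul x y) = htmul (S x) (T y) := by
  simp [htmul_apply, opTensor]

/-- A closed, additive property of vectors which holds for elementary tensors holds everywhere. -/
theorem HTensor.induction_on {p : HTensor H K → Prop} (ξ : HTensor H K)
    (closed : IsClosed {ξ | p ξ}) (tmul : ∀ x y, p (htmul x y))
    (add : ∀ ξ η, p ξ → p η → p (ξ + η)) : p ξ := by
  refine UniformSpace.Completion.induction_on ξ closed fun t => ?_
  induction t with
  | zero => simpa only [htmul_apply, TensorProduct.zero_tmul] using tmul 0 0
  | tmul x y => exact tmul x y
  | add t s ht hs => simpa only [UniformSpace.Completion.coe_add] using add _ _ ht hs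

theorem HTensor.ext_inner {ξ η : HTensor H K}
    (h : ∀ x y, ⟪htmul x y, ξ⟫_ℂ = ⟪htmul x y, η⟫_ℂ) : ξ = η := by
  refine ext_inner_left ℂ fun ζ => ?_
  induction ζ using HTensor.induction_on with
  | closed => exact isClosed_eq (by fun_prop) (by fun_prop)
  | tmul x y => exact h x y
  | add ξ η h₁ h₂ => rw [inner_add_left, inner_add_left, h₁, h₂]

theorem HTensor.clm_ext {E : Type w} [NormedAddCommGroup E] [NormedSpace ℂ E]
    {f g : HTensor H K →L[ℂ] E} (h : ∀ x y, f (htmul x y) = g (htmul x y)) : f = g := by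
  ext ξ
  induction ξ using HTensor.induction_on with
  | closed => exact isClosed_eq (by fun_prop) (by fun_prop)
  | tmul x y => exact h x y
  | add ξ η h₁ h₂ => rw [map_add, map_add, h₁, h₂]

theorem opTensor_comp (S S' : H →L[ℂ] H) (T T' : K →L[ℂ] K) :
    opTensor S T ∘L opTensor S' T' = opTensor (S ∘L S') (T ∘L T') :=
  HTensor.clm_ext fun x y => by simp [opTensor_htmul]

theorem opTensor_opTensor (S S' : H →L[ℂ] H) (T T' : K →L[ℂ] K) (ξ : HTensor H K) :
    opTensor S T (opTensor S' T' ξ) = opTensor (S ∘L S') (T ∘L T') ξ := by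
  rw [← opTensor_comp]; rfl

theorem opTensor_sum_left {ι : Type*} (s : Finset ι) (S : ι → H →L[ℂ] H) (T : K →L[ℂ] K) :
    opTensor (∑ i ∈ s, S i) T = ∑ i ∈ s, opTensor (S i) T :=
  HTensor.clm_ext fun x y => by simp [opTensor_htmul]

theorem opTensor_sum_right {ι : Type*} (s : Finset ι) (S : H →L[ℂ] H) (T : ι → K →L[ℂ] K) :
    opTensor S (∑ i ∈ s, T i) = ∑ i ∈ s, opTensor S (T i) :=
  HTensor.clm_ext fun x y => by simp [opTensor_htmul]

@[simp] theorem opTensor_zero_left (T : K →L[ℂ] K) : opTensor (0 : H →L[ℂ] H) T = 0 :=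
  HTensor.clm_ext fun x y => by simp [opTensor_htmul]

@[simp] theorem opTensor_zero_right (S : H →L[ℂ] H) : opTensor S (0 : K →L[ℂ] K) = 0 :=
  HTensor.clm_ext fun x y => by simp [opTensor_htmul]

@[simp] theorem opTensor_one : opTensor (1 : H →L[ℂ] H) (1 : K →L[ℂ] K) = 1 :=
  HTensor.clm_ext fun x y => by simp [opTensor_htmul]

theorem norm_opTensor_le (S : H →L[ℂ] H) (T : K →L[ℂ] K) (ξ : HTensor H K) :
    ‖opTensor S T ξ‖ ≤ ‖S‖ * ‖T‖ * ‖ξ‖ := by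
  induction ξ using UniformSpace.Completion.induction_on with
  | hp => exact isClosed_le (by fun_prop) (by fun_prop)
  | ih t =>
    simp only [opTensor, ContinuousLinearMap.completion_apply_coe,
      UniformSpace.Completion.norm_coe]
    exact (TensorProduct.mapL S T).le_of_opNorm_le (TensorProduct.norm_mapL_le S T) t

variable [CompleteSpace K]

/-- The conjugate linear operator `x ↦ (f x)† ξ` associated with a bounded bilinear map `f`. -/
def adjointFlip {E F : Type*} [NormedAddCommGroup E] [NormedSpace ℂ E] [NormedAddCommGroup F]
    [InnerProductSpace ℂ F] [CompleteSpace F] {G : Type*} [NormedAddCommGroup G]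
    [InnerProductSpace ℂ G] [CompleteSpace G] (f : E →L[ℂ] F →L[ℂ] G) : G →L[ℂ] E →L⋆[ℂ] F :=
  ContinuousLinearMap.flip
    ((ContinuousLinearMap.adjoint (𝕜 := ℂ) (E := F) (F := G)).toContinuousLinearEquiv
      |>.toContinuousLinearMap.comp f)

theorem inner_adjointFlip {E F : Type*} [NormedAddCommGroup E] [NormedSpace ℂ E]
    [NormedAddCommGroup F] [InnerProductSpace ℂ F] [CompleteSpace F] {G : Type*}
    [NormedAddCommGroup G] [InnerProductSpace ℂ G] [CompleteSpace G] (f : E →L[ℂ] F →L[ℂ] G)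
    (ξ : G) (x : E) (y : F) : ⟪y, adjointFlip f ξ x⟫_ℂ = ⟪f x y, ξ⟫_ℂ :=
  ContinuousLinearMap.adjoint_inner_right (f x) y ξ

/-- The conjugate linear operator `x ↦ (⟨x| ⊗ 1) ξ` associated with a vector `ξ` of the Hilbert
space tensor product. -/
def contract : HTensor H K →L[ℂ] H →L⋆[ℂ] K := adjointFlip htmul

theorem inner_contract (ξ : HTensor H K) (x : H) (y : K) :
    ⟪y, contract ξ x⟫_ℂ = ⟪htmul x y, ξ⟫_ℂ :=
  inner_adjointFlip htmul ξ x y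

theorem contract_htmul (x' x : H) (y : K) : contract (htmul x' y) x = ⟪x, x'⟫_ℂ • y :=
  ext_inner_left ℂ fun z => by rw [inner_contract, inner_htmul, inner_smul_right]

/-- Elementary tensors contract to operators of rank at most one, and compactness survives sums and
norm limits. -/
theorem isCompactOperator_contract (ξ : HTensor H K) : IsCompactOperator (contract ξ) := by
  induction ξ using HTensor.induction_on with
  | closed =>
    exact (isClosed_setOfPred_isCompactOperator (M₁ := H) (M₂ := K)).preimage
      (contract (H := H) (K := K)).continuous
  | add ξ η h₁ h₂ => rw [map_add]; exact h₁.add h₂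
  | tmul x' y =>
    have h : ⇑(contract (htmul x' y)) = (fun c : ℂ => c • y) ∘ fun x => ⟪x, x'⟫_ℂ := by
      ext x; exact contract_htmul x' x y
    rw [h]
    refine ⟨(fun c : ℂ => c • y) '' Metric.closedBall 0 1,
      (isCompact_closedBall _ _).image (by fun_prop), ?_⟩
    have : Continuous fun x => ⟪x, x'⟫_ℂ := by fun_prop
    have h0 : Metric.closedBall (0 : ℂ) 1 ∈ nhds (⟪(0 : H), x'⟫_ℂ) := by
      rw [inner_zero_left]; exact Metric.closedBall_mem_nhds _ one_pos
    exact Filter.mem_of_superset (this.continuousAt h0) fun x hx => ⟨_, hx, rfl⟩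

variable [CompleteSpace H]

theorem inner_opTensor_left (S : H →L[ℂ] H) (T : K →L[ℂ] K) (ξ η : HTensor H K) :
    ⟪opTensor S T ξ, η⟫_ℂ =
      ⟪ξ, opTensor (ContinuousLinearMap.adjoint S) (ContinuousLinearMap.adjoint T) η⟫_ℂ := by
  induction ξ using HTensor.induction_on with
  | closed => exact isClosed_eq (by fun_prop) (by fun_prop)
  | add ξ₁ ξ₂ h₁ h₂ => rw [map_add, inner_add_left, inner_add_left, h₁, h₂]
  | tmul x y =>
    induction η using HTensor.induction_on with
    | closed => exact isClosed_eq (by fun_prop) (by fun_prop)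
    | add ξ₁ ξ₂ h₁ h₂ => rw [map_add, inner_add_right, inner_add_right, h₁, h₂]
    | tmul x' y' =>
      simp only [opTensor_htmul, inner_htmul, ContinuousLinearMap.adjoint_inner_right]

theorem contract_opTensor (S : H →L[ℂ] H) (T : K →L[ℂ] K) (ξ : HTensor H K) (x : H) :
    contract (opTensor S T ξ) x = T (contract ξ (ContinuousLinearMap.adjoint S x)) :=
  ext_inner_left ℂ fun z => by
    rw [inner_contract, ← ContinuousLinearMap.adjoint_inner_left T, inner_contract,
      ← opTensor_htmul, inner_opTensor_left]
    simp

/-- The operator `T† T`, where `T` is the contraction by `ξ`. -/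
def gram (ξ : HTensor H K) : H →L[ℂ] H :=
  (adjointFlip (htmul (H := H) (K := K)).flip ξ).comp (contract ξ)

/-- The arguments appear in reversed order on the right because `contract ξ` is conjugate linear. -/
theorem inner_gram (ξ : HTensor H K) (x y : H) :
    ⟪x, gram ξ y⟫_ℂ = ⟪contract ξ y, contract ξ x⟫_ℂ := by
  rw [inner_contract]
  exact inner_adjointFlip _ ξ (contract ξ y) x

theorem isCompactOperator_gram (ξ : HTensor H K) : IsCompactOperator (gram ξ) :=
  (isCompactOperator_contract ξ).continuous_comp
    (adjointFlip (htmul (H := H) (K := K)).flip ξ).continuous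

theorem isSymmetric_gram (ξ : HTensor H K) : (gram ξ : H →ₗ[ℂ] H).IsSymmetric := fun x y => by
  change ⟪gram ξ x, y⟫_ℂ = ⟪x, gram ξ y⟫_ℂ
  rw [← inner_conj_symm, inner_gram, inner_conj_symm, inner_gram]

/-- The kernel of `T† T` is that of `T`. This disposes of the eigenvalue `0`, whose eigenspace may
be infinite-dimensional. -/
theorem contract_eq_zero_of_gram_eq_zero {ξ : HTensor H K} {x : H} (h : gram ξ x = 0) :
    contract ξ x = 0 := by
  rw [← inner_self_eq_zero (𝕜 := ℂ), ← inner_gram, h, inner_zero_right]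

/-- If the contraction by `ξ` intertwines `S` with `T` and `S†` with `T†`, then `S` commutes with
`gram ξ`. -/
theorem gram_apply_comm {ξ : HTensor H K} {S : H →L[ℂ] H} {T : K →L[ℂ] K}
    (h : ∀ x, T (contract ξ x) = contract ξ (S x))
    (h' : ∀ x, ContinuousLinearMap.adjoint T (contract ξ x) =
      contract ξ (ContinuousLinearMap.adjoint S x)) (x : H) :
    gram ξ (S x) = S (gram ξ x) :=
  ext_inner_left ℂ fun y => by
    rw [inner_gram, ← h, ← ContinuousLinearMap.adjoint_inner_right, h', ← inner_gram,
      ContinuousLinearMap.adjoint_inner_left]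

end Tensor

/-! ### Positive block operators. -/

theorem exists_eq_adjoint_comp_self {E : Type w} [NormedAddCommGroup E] [InnerProductSpace ℂ E]
    [CompleteSpace E] {T : E →L[ℂ] E} (hT : T.IsPositive) :
    ∃ S : E →L[ℂ] E, T = ContinuousLinearMap.adjoint S ∘L S :=
  CStarAlgebra.nonneg_iff_eq_star_mul_self.1 ((ContinuousLinearMap.nonneg_iff_isPositive T).2 hT)

section Block

variable {n : ℕ} {H : Type u} [NormedAddCommGroup H] [InnerProductSpace ℂ H]

theorem inner_blockOp_single (M : Matrix (Fin n) (Fin n) (H →L[ℂ] H)) (i j : Fin n) (x y : H) :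
    ⟪PiLp.single 2 i x, blockOp M (PiLp.single 2 j y)⟫_ℂ = ⟪x, M i j y⟫_ℂ := by
  rw [PiLp.inner_apply, Finset.sum_eq_single i, blockOp_apply, Finset.sum_eq_single j]
  · simp
  · intro k _ hk; simp [hk]
  · simp
  · intro k _ hk; simp [hk]
  · simp

theorem IsPOVM.sum_apply {c : ℕ} {P : Fin c → Matrix (Fin n) (Fin n) (H →L[ℂ] H)} (hP : IsPOVM P)
    (i j : Fin n) : ∑ a, P a i j = if i = j then 1 else 0 := by
  have := congrFun (congrFun hP.sum_eq_one i) j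
  rwa [Matrix.sum_apply, Matrix.one_apply] at this

variable [CompleteSpace H]

theorem adjoint_block_of_isPositive {M : Matrix (Fin n) (Fin n) (H →L[ℂ] H)}
    (hM : (blockOp M).IsPositive) (i j : Fin n) :
    ContinuousLinearMap.adjoint (M i j) = M j i := by
  refine ContinuousLinearMap.ext fun x => ext_inner_left ℂ fun y => ?_
  rw [ContinuousLinearMap.adjoint_inner_right, ← inner_blockOp_single M j i,
    ← hM.inner_left_eq_inner_right, ← inner_conj_symm (blockOp M _), inner_blockOp_single,
    inner_conj_symm]

/-- A positive block operator factors as `A† A`, blockwise. -/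
theorem exists_block_factorization {M : Matrix (Fin n) (Fin n) (H →L[ℂ] H)}
    (hM : (blockOp M).IsPositive) :
    ∃ A : Matrix (Fin n) (Fin n) (H →L[ℂ] H),
      ∀ i j, M i j = ∑ m, ContinuousLinearMap.adjoint (A m i) ∘L A m j := by
  obtain ⟨S, hS⟩ := exists_eq_adjoint_comp_self hM
  let s (i : Fin n) : H →L[ℂ] PiLp 2 (fun _ : Fin n => H) :=
    (PiLp.continuousLinearEquiv 2 ℂ (fun _ : Fin n => H)).symm.toContinuousLinearMap ∘L
      ContinuousLinearMap.single ℂ (fun _ : Fin n => H) i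
  have hs (i : Fin n) (x : H) : s i x = PiLp.single 2 i x := rfl
  refine ⟨fun m i => PiLp.proj 2 (fun _ : Fin n => H) m ∘L S ∘L s i, fun i j => ?_⟩
  refine ContinuousLinearMap.ext fun x => ext_inner_left ℂ fun y => ?_
  rw [← inner_blockOp_single M i j, hS, ContinuousLinearMap.comp_apply,
    ContinuousLinearMap.adjoint_inner_right, PiLp.inner_apply,
    sum_apply, inner_sum]
  refine Finset.sum_congr rfl fun m _ => ?_
  rw [ContinuousLinearMap.comp_apply, ContinuousLinearMap.adjoint_inner_right]
  rfl

end Block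

/-! ### Consequences of synchronicity for the state. -/

section Joint

theorem bellState_apply {n : ℕ} (S : Finset (Fin n)) (jl : Fin n × Fin n) :
    bellState S jl = if jl.1 = jl.2 ∧ jl.1 ∈ S then
      ((1 / Real.sqrt (S.card : ℝ) : ℝ) : ℂ) else 0 := by
  obtain ⟨j, l⟩ := jl
  rw [bellState, PiLp.smul_apply, WithLp.ofLp_sum, Finset.sum_apply]
  by_cases h : j = l
  · subst h
    by_cases hj : j ∈ S
    · rw [Finset.sum_eq_single j (fun k _ hk => by simp [hk.symm]) (by simp [hj])]
      simp [hj]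
    · rw [Finset.sum_eq_zero fun k hk => by
        have : j ≠ k := fun e => hj (e ▸ hk)
        simp [this]]
      simp [hj]
  · rw [Finset.sum_eq_zero fun k hk => by
      have : ¬ (j = k ∧ l = k) := fun e => h (e.1.trans e.2.symm)
      simp [this]]
    simp [h]

variable {n : ℕ} {H : Type u} {K : Type v} [NormedAddCommGroup H] [InnerProductSpace ℂ H]
  [NormedAddCommGroup K] [InnerProductSpace ℂ K] [CompleteSpace H] [CompleteSpace K]

/-- If `M ⊗ N` with `M, N ≥ 0` has zero expectation in `ψ`, then it annihilates `ψ`. -/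
theorem blockOp_opTensor_eq_zero {M : Matrix (Fin n) (Fin n) (H →L[ℂ] H)}
    {N : Matrix (Fin n) (Fin n) (K →L[ℂ] K)} (hM : (blockOp M).IsPositive)
    (hN : (blockOp N).IsPositive) (ψ : PiLp 2 (fun _ : Fin n × Fin n => HTensor H K))
    (h : ⟪ψ, blockOp (Matrix.of fun ik jl : Fin n × Fin n =>
      opTensor (M ik.1 jl.1) (N ik.2 jl.2)) ψ⟫_ℂ = 0) (i k : Fin n) :
    ∑ jl : Fin n × Fin n, opTensor (M i jl.1) (N k jl.2) (ψ jl) = 0 := by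
  obtain ⟨A, hA⟩ := exists_block_factorization hM
  obtain ⟨B, hB⟩ := exists_block_factorization hN
  -- With `M = A† A` and `N = B† B`, these are the components of `(A ⊗ B) ψ`, and the expectation of
  -- `M ⊗ N` is the sum of their squared norms.
  let ω (m r : Fin n) : HTensor H K := ∑ jl : Fin n × Fin n, opTensor (A m jl.1) (B r jl.2) (ψ jl)
  have key (i k : Fin n) : ∑ jl : Fin n × Fin n, opTensor (M i jl.1) (N k jl.2) (ψ jl) =
      ∑ m, ∑ r, opTensor (ContinuousLinearMap.adjoint (A m i))
        (ContinuousLinearMap.adjoint (B r k)) (ω m r) := by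
    simp only [ω, map_sum, opTensor_opTensor, hA, hB, opTensor_sum_left, opTensor_sum_right,
      sum_apply]
    rw [Finset.sum_comm]
    conv_rhs => rw [Finset.sum_comm]
    refine Finset.sum_congr rfl fun r _ => ?_
    rw [Finset.sum_comm]
  have hω : ∑ m, ∑ r, ⟪ω m r, ω m r⟫_ℂ = 0 := by
    rw [← h, PiLp.inner_apply]
    simp only [blockOp_apply, Matrix.of_apply, key, inner_sum]
    conv_rhs => rw [Finset.sum_comm]
    refine Finset.sum_congr rfl fun m _ => ?_
    conv_rhs => rw [Finset.sum_comm]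
    refine Finset.sum_congr rfl fun r _ => ?_
    calc ⟪ω m r, ω m r⟫_ℂ
        = ⟪∑ jl : Fin n × Fin n, opTensor (A m jl.1) (B r jl.2) (ψ jl), ω m r⟫_ℂ := rfl
      _ = _ := by
        rw [sum_inner]
        exact Finset.sum_congr rfl fun jl _ => inner_opTensor_left _ _ _ _
  have hz (m r : Fin n) : ω m r = 0 := by
    have h0 : ∑ m, ∑ r, ‖ω m r‖ ^ 2 = 0 := by
      have := congrArg Complex.re hω
      simpa only [inner_self_eq_norm_sq_to_K, Complex.re_sum, Complex.zero_re,
        Complex.coe_algebraMap, ← Complex.ofReal_pow, Complex.ofReal_re] using this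
    rw [Finset.sum_eq_zero_iff_of_nonneg fun _ _ => Finset.sum_nonneg fun _ _ => by positivity] at h0
    have h1 := h0 m (Finset.mem_univ _)
    rw [Finset.sum_eq_zero_iff_of_nonneg fun _ _ => by positivity] at h1
    simpa using h1 r (Finset.mem_univ _)
  simp [key, hz]

variable {c : ℕ}

theorem Strategy.sum_opTensor_eq_zero (S : Strategy n c H K) {s : Finset (Fin n)}
    {a b : Fin c} (h : S.correlation.prob (bellState s) a b = 0) (i k : Fin n) :
    ∑ j ∈ s, opTensor (S.P a i j) (S.Q b k j) S.χ = 0 := by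
  rcases s.eq_empty_or_nonempty with rfl | hs
  · simp
  rw [Strategy.prob_correlation] at h
  have h' := blockOp_opTensor_eq_zero (S.povm_P.pos a) (S.povm_Q.pos b) _ h i k
  simp only [inputState, bellState_apply, map_smul] at h'
  rw [Fintype.sum_prod_type] at h'
  have h2 : (((1 / Real.sqrt (s.card : ℝ) : ℝ) : ℂ)) ≠ 0 := by
    have : (0 : ℝ) < s.card := by exact_mod_cast hs.card_pos
    exact Complex.ofReal_ne_zero.2 (by positivity)
  have h3 : (((1 / Real.sqrt (s.card : ℝ) : ℝ) : ℂ)) •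
      ∑ j ∈ s, opTensor (S.P a i j) (S.Q b k j) S.χ = 0 := by
    rw [← h', Finset.smul_sum, ← Finset.sum_subset (Finset.subset_univ s)]
    · refine Finset.sum_congr rfl fun j hj => ?_
      rw [Finset.sum_eq_single j (fun l _ hl => by simp [hl.symm]) (by simp)]
      simp [hj]
    · intro j _ hj
      exact Finset.sum_eq_zero fun l _ => by simp [hj]
  exact (smul_eq_zero.1 h3).resolve_left h2

/-- In a synchronous strategy Alice's operators act on the state as Bob's transposed ones. -/
theorem Strategy.opTensor_one_eq (S : Strategy n c H K) (hS : S.correlation.IsSynchronous)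
    (a : Fin c) (i k : Fin n) :
    opTensor (S.P a i k) 1 S.χ = opTensor 1 (S.Q a k i) S.χ := by
  obtain ⟨π, hπ⟩ := hS
  -- The terms with `b ≠ a` vanish, so summing over all `b` is free; then `∑ b, Q b k j` is `1` or
  -- `0` and leaves only `j = k`. `hB` is the same with Alice and Bob exchanged.
  have hA (s) (hs : s ∈ π.parts) (i k : Fin n) :
      ∑ j ∈ s, opTensor (S.P a i j) (S.Q a k j) S.χ =
        if k ∈ s then opTensor (S.P a i k) 1 S.χ else 0 := by
    calc _ = ∑ b, ∑ j ∈ s, opTensor (S.P a i j) (S.Q b k j) S.χ := by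
          rw [Finset.sum_eq_single a (fun b _ hb =>
            S.sum_opTensor_eq_zero (hπ s hs a b hb.symm) i k) (by simp)]
      _ = ∑ j ∈ s, opTensor (S.P a i j) (∑ b, S.Q b k j) S.χ := by
          rw [Finset.sum_comm]
          exact Finset.sum_congr rfl fun j _ => by rw [opTensor_sum_right, sum_apply]
      _ = _ := by
          simp only [S.povm_Q.sum_apply]
          split_ifs with hk
          · rw [Finset.sum_eq_single k (fun j _ hj => by simp [hj.symm]) (by simp [hk])]
            simp
          · refine Finset.sum_eq_zero fun j hj => ?_
            have : k ≠ j := fun e => hk (e ▸ hj)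
            simp [this]
  have hB (s) (hs : s ∈ π.parts) (i k : Fin n) :
      ∑ j ∈ s, opTensor (S.P a i j) (S.Q a k j) S.χ =
        if i ∈ s then opTensor 1 (S.Q a k i) S.χ else 0 := by
    calc _ = ∑ b, ∑ j ∈ s, opTensor (S.P b i j) (S.Q a k j) S.χ := by
          rw [Finset.sum_eq_single a (fun b _ hb =>
            S.sum_opTensor_eq_zero (hπ s hs b a hb) i k) (by simp)]
      _ = ∑ j ∈ s, opTensor (∑ b, S.P b i j) (S.Q a k j) S.χ := by
          rw [Finset.sum_comm]
          exact Finset.sum_congr rfl fun j _ => by rw [opTensor_sum_left, sum_apply]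
      _ = _ := by
          simp only [S.povm_P.sum_apply]
          split_ifs with hk
          · rw [Finset.sum_eq_single i (fun j _ hj => by simp [hj.symm]) (by simp [hk])]
            simp
          · refine Finset.sum_eq_zero fun j hj => ?_
            have : i ≠ j := fun e => hk (e ▸ hj)
            simp [this]
  have hAB (s) (hs : s ∈ π.parts) := (hA s hs i k).symm.trans (hB s hs i k)
  obtain ⟨s, hs, hks⟩ := π.exists_mem (Finset.mem_univ k)
  obtain ⟨t, ht, hit⟩ := π.exists_mem (Finset.mem_univ i)
  -- If `i` and `k` share a block, both sides are the same sum. Otherwise the block of `k` kills the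
  -- left side and that of `i` the right side.
  by_cases his : i ∈ s
  · simpa [hks, his] using hAB s hs
  · have hkt : k ∉ t := fun hkt => his (π.eq_of_mem_parts hs ht hks hkt ▸ hit)
    have h1 := hAB s hs
    have h2 := hAB t ht
    simp only [hks, his, hkt, hit, if_true, if_false] at h1 h2
    rw [h1, ← h2]

/-- The contraction by the state intertwines Alice's and Bob's operators. -/
theorem Strategy.apply_contract (S : Strategy n c H K) (hS : S.correlation.IsSynchronous)
    (a : Fin c) (i k : Fin n) (x : H) :
    S.Q a i k (contract S.χ x) = contract S.χ (S.P a i k x) := by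
  -- Contraction turns Alice's operator into its adjoint, which swaps the indices back to `i k`.
  have := congrArg (fun ξ => contract ξ x) (S.opTensor_one_eq hS a k i)
  simpa [contract_opTensor, adjoint_block_of_isPositive (S.povm_P.pos a),
    ← ContinuousLinearMap.star_eq_adjoint] using this.symm

end Joint

/-! ### Decomposing a vector along orthogonal subspaces of the first factor. -/

section Decomposition

open Submodule

theorem isClosed_setOf_hasSum_self {ι : Type*} {E : Type w} [NormedAddCommGroup E]
    [NormedSpace ℂ E] (A : ι → E →L[ℂ] E) (hA : ∀ (F : Finset ι) x, ‖∑ i ∈ F, A i x‖ ≤ ‖x‖) :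
    IsClosed {x | HasSum (fun i => A i x) x} := by
  refine isClosed_of_closure_subset fun x hx => ?_
  refine Metric.tendsto_nhds.2 fun ε hε => ?_
  obtain ⟨y, hy, hxy⟩ := Metric.mem_closure_iff.1 hx (ε / 3) (by positivity)
  filter_upwards [Metric.tendsto_nhds.1 hy (ε / 3) (by positivity)] with F hF
  rw [dist_eq_norm] at hF hxy ⊢
  have h : ∑ i ∈ F, A i x - x = ∑ i ∈ F, A i (x - y) + ((∑ i ∈ F, A i y - y) - (x - y)) := by
    simp only [map_sub, Finset.sum_sub_distrib]; abel
  rw [h]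
  calc _ ≤ ‖x - y‖ + (‖∑ i ∈ F, A i y - y‖ + ‖x - y‖) :=
        (norm_add_le _ _).trans (add_le_add (hA F _) (norm_sub_le _ _))
    _ < ε := by linarith

variable {H : Type u} {K : Type v} [NormedAddCommGroup H] [InnerProductSpace ℂ H]
  [NormedAddCommGroup K] [InnerProductSpace ℂ K]

/-- A subspace invariant under an operator and its adjoint (here `S'`) is reducing. -/
theorem starProjection_apply_comm {V : Submodule ℂ H} [V.HasOrthogonalProjection]
    {S S' : H →L[ℂ] H} (hS : ∀ x y, ⟪S x, y⟫_ℂ = ⟪x, S' y⟫_ℂ) (h : ∀ x ∈ V, S x ∈ V)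
    (h' : ∀ x ∈ V, S' x ∈ V) (x : H) : V.starProjection (S x) = S (V.starProjection x) := by
  refine eq_starProjection_of_mem_of_inner_eq_zero (h _ (starProjection_apply_mem V x))
    fun y hy => ?_
  rw [← map_sub, hS]
  exact starProjection_inner_eq_zero _ _ (h' y hy)

variable {ι : Type*} {V : ι → Submodule ℂ H} [∀ i, CompleteSpace (V i)]

theorem starProjection_comp_of_orthogonalFamily
    (hV : OrthogonalFamily ℂ (fun i => V i) fun i => (V i).subtypeₗᵢ) {i j : ι} (hij : i ≠ j) :
    (V i).starProjection ∘L (V j).starProjection = 0 := by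
  ext x
  refine (eq_starProjection_of_mem_of_inner_eq_zero (zero_mem _) fun y hy => ?_)
  rw [zero_apply, sub_zero]
  exact hV hij.symm ⟨_, starProjection_apply_mem (V j) x⟩ ⟨y, hy⟩

/-- The sum `p` satisfies `⟪p, p⟫ = ⟪p, x⟫`, so Cauchy–Schwarz applies. -/
theorem norm_sum_starProjection_le
    (hV : OrthogonalFamily ℂ (fun i => V i) fun i => (V i).subtypeₗᵢ) (F : Finset ι) (x : H) :
    ‖∑ i ∈ F, (V i).starProjection x‖ ≤ ‖x‖ := by
  set p := ∑ i ∈ F, (V i).starProjection x with hp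
  have h : ⟪p, p⟫_ℂ = ⟪p, x⟫_ℂ := by
    rw [hp, sum_inner, sum_inner]
    refine Finset.sum_congr rfl fun i hi => ?_
    have hj (j) (_ : j ∈ F) (hj : j ≠ i) :
        ⟪(V i).starProjection x, (V j).starProjection x⟫_ℂ = 0 :=
      hV hj.symm ⟨_, starProjection_apply_mem (V i) x⟩ ⟨_, starProjection_apply_mem (V j) x⟩
    rw [inner_sum, Finset.sum_eq_single i hj (fun h => absurd hi h)]
    rw [← inner_starProjection_left_eq_right, (V i).starProjection_eq_self_iff.2
      (starProjection_apply_mem (V i) x)]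
  have h2 : ‖p‖ * ‖p‖ ≤ ‖p‖ * ‖x‖ := by
    rw [← inner_self_eq_norm_mul_norm (𝕜 := ℂ), h]
    exact re_inner_le_norm p x
  rcases (norm_nonneg p).eq_or_lt with h0 | h0
  · rw [← h0]; exact norm_nonneg x
  · exact le_of_mul_le_mul_left h2 h0

variable [CompleteSpace H]

theorem hasSum_starProjection
    (hV : OrthogonalFamily ℂ (fun i => V i) fun i => (V i).subtypeₗᵢ) (hd : (⨆ i, V i)ᗮ = ⊥)
    (x : H) : HasSum (fun i => (V i).starProjection x) x := by
  have hs := IsHilbertSum.mkInternal V hV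
    (topologicalClosure_eq_top_iff.2 hd).ge
  obtain ⟨w, rfl⟩ := hs.linearIsometryEquiv.symm.surjective x
  have hw := hs.hasSum_linearIsometryEquiv_symm w
  convert hw using 2 with i
  have := (V i).starProjection.hasSum hw
  refine this.unique ?_
  have h1 : (V i).starProjection ((V i).subtypeₗᵢ (w i)) = (V i).subtypeₗᵢ (w i) :=
    (V i).starProjection_eq_self_iff.2 (w i).2
  conv => arg 2; rw [← h1]
  refine hasSum_single i fun j hj => ?_
  refine (eq_starProjection_of_mem_of_inner_eq_zero (zero_mem _) fun y hy => ?_)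
  rw [sub_zero]
  exact hV hj (w j) ⟨y, hy⟩

/-- The partial sums are contractions, so convergence passes to limits and need only be checked on
elementary tensors. -/
theorem hasSum_opTensor_starProjection
    (hV : OrthogonalFamily ℂ (fun i => V i) fun i => (V i).subtypeₗᵢ) (hd : (⨆ i, V i)ᗮ = ⊥)
    (ξ : HTensor H K) : HasSum (fun i => opTensor (V i).starProjection 1 ξ) ξ := by
  induction ξ using HTensor.induction_on with
  | closed =>
    refine isClosed_setOf_hasSum_self (fun i => opTensor (V i).starProjection 1) fun F ξ => ?_
    rw [← sum_apply, ← opTensor_sum_left]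
    have h1 : ‖∑ i ∈ F, (V i).starProjection‖ ≤ 1 :=
      ContinuousLinearMap.opNorm_le_bound _ zero_le_one fun x => by
        rw [sum_apply, one_mul]; exact norm_sum_starProjection_le hV F x
    have h2 : ‖(1 : K →L[ℂ] K)‖ ≤ 1 := ContinuousLinearMap.norm_id_le
    calc _ ≤ _ := norm_opTensor_le _ _ ξ
      _ ≤ 1 * 1 * ‖ξ‖ := by gcongr
      _ = ‖ξ‖ := by ring
  | tmul x y =>
    simp only [opTensor_htmul]
    exact ((htmul (H := H) (K := K)).flip y).hasSum (hasSum_starProjection hV hd x)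
  | add ξ η h₁ h₂ => simpa only [map_add] using h₁.add h₂

variable [CompleteSpace K]

theorem inner_opTensor_starProjection
    (hV : OrthogonalFamily ℂ (fun i => V i) fun i => (V i).subtypeₗᵢ) {S : H →L[ℂ] H}
    (hS : ∀ i x, (V i).starProjection (S x) = S ((V i).starProjection x)) (T : K →L[ℂ] K)
    (ξ : HTensor H K) (i j : ι) [Decidable (i = j)] :
    ⟪opTensor (V i).starProjection 1 ξ, opTensor S T (opTensor (V j).starProjection 1 ξ)⟫_ℂ =
      if i = j then ⟪ξ, opTensor S T (opTensor (V j).starProjection 1 ξ)⟫_ℂ else 0 := by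
  have hc : (V i).starProjection ∘L S = S ∘L (V i).starProjection :=
    ContinuousLinearMap.ext (hS i)
  rw [inner_opTensor_left, (isSelfAdjoint_starProjection (V i)).adjoint_eq, opTensor_opTensor,
    opTensor_opTensor, hc, ContinuousLinearMap.comp_assoc]
  split_ifs with hij
  · subst hij
    rw [opTensor_opTensor, show (V i).starProjection ∘L (V i).starProjection =
      (V i).starProjection from (V i).isIdempotentElem_starProjection]
    congr 2
    rw [show ContinuousLinearMap.adjoint (1 : K →L[ℂ] K) = 1 from star_one _,
      ContinuousLinearMap.one_def, ContinuousLinearMap.id_comp]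
  · rw [starProjection_comp_of_orthogonalFamily hV hij]
    simp

/-- This places the component of `ξ` over `U` in the algebraic tensor product of `U` and its image
under the contraction, so Bob's space becomes finite-dimensional as well. -/
theorem opTensor_starProjection_eq_sum (U : Submodule ℂ H) [FiniteDimensional ℂ U]
    (ξ : HTensor H K) : opTensor U.starProjection 1 ξ =
      ∑ i, htmul (stdOrthonormalBasis ℂ U i : H) (contract ξ (stdOrthonormalBasis ℂ U i : H)) := by
  refine HTensor.ext_inner fun x y => ?_
  have hx : U.starProjection x = ∑ i, ⟪(stdOrthonormalBasis ℂ U i : H), x⟫_ℂ •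
      (stdOrthonormalBasis ℂ U i : H) := by
    rw [(stdOrthonormalBasis ℂ U).starProjection_eq_sum_rankOne]
    simp [InnerProductSpace.rankOne_apply]
  rw [← inner_conj_symm, inner_opTensor_left, inner_conj_symm,
    (isSelfAdjoint_starProjection U).adjoint_eq, opTensor_htmul, hx]
  simp [inner_sum, sum_inner, inner_smul_left, inner_htmul, inner_contract,
    ← ContinuousLinearMap.star_eq_adjoint]

end Decomposition

/-! ### Convergent series in finite dimension. -/

section Cone

/-- In a finite-dimensional space, the sum of a convergent series is a finite combination of its
terms with nonnegative coefficients. -/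
theorem exists_finset_sum_smul_eq_of_hasSum {E ι : Type*} [NormedAddCommGroup E] [NormedSpace ℝ E]
    [FiniteDimensional ℝ E] {x : ι → E} {s : E} (h : HasSum x s) :
    ∃ (F : Finset ι) (d : ι → ℝ), (∀ i, 0 ≤ d i) ∧ s = ∑ i ∈ F, d i • x i := by
  classical
  -- A basis of the span is chosen among the terms, so that a remainder can be absorbed into their
  -- coefficients.
  obtain ⟨κ, a, ha, hsp, hli⟩ := exists_linearIndependent' ℝ x
  have : Finite κ := hli.finite
  have : Fintype κ := Fintype.ofFinite κ
  let W : Submodule ℝ E := Submodule.span ℝ (Set.range (x ∘ a))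
  let b : Module.Basis κ ℝ W := Module.Basis.span hli
  have hb (k : κ) : (b k : E) = x (a k) :=
    congrArg Subtype.val (Module.Basis.span_apply hli k)
  have hx (i : ι) : x i ∈ W := by
    change x i ∈ Submodule.span ℝ (Set.range (x ∘ a))
    rw [hsp]; exact Submodule.subset_span ⟨i, rfl⟩
  have hsF (F : Finset ι) : ∑ i ∈ F, x i ∈ W := Submodule.sum_mem _ fun i _ => hx i
  have hs : s ∈ W := W.closed_of_finiteDimensional.mem_of_tendsto h (.of_forall hsF)
  let r (F : Finset ι) : W := ⟨s, hs⟩ - ⟨∑ i ∈ F, x i, hsF F⟩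
  have hr : Filter.Tendsto r Filter.atTop (nhds 0) := by
    rw [tendsto_subtype_rng]
    simpa [r] using (tendsto_const_nhds (x := s)).sub h
  -- Each term in `F` has coefficient `1` in the partial sum, so adding remainder coordinates that
  -- are at least `-1` keeps the coefficients nonnegative.
  have hc (k : κ) : ∀ᶠ F in Filter.atTop, -1 ≤ b.repr (r F) k := by
    have h1 : Filter.Tendsto (fun F => b.coord k (r F)) Filter.atTop (nhds 0) := by
      have h2 := ((b.coord k).continuous_of_finiteDimensional.tendsto 0).comp hr
      rwa [map_zero] at h2
    exact h1.eventually (Ici_mem_nhds (by norm_num))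
  obtain ⟨F, hF, haF⟩ := ((Filter.eventually_all.2 hc).and
    (Filter.eventually_ge_atTop (Finset.univ.image a))).exists
  refine ⟨F, fun i => 1 + ∑ k, if a k = i then b.repr (r F) k else 0, fun i => ?_, ?_⟩
  · beta_reduce
    by_cases hi : ∃ k, a k = i
    · obtain ⟨k, rfl⟩ := hi
      rw [Finset.sum_eq_single k (fun l _ hl => by simp [ha.ne hl]) (by simp)]
      have := hF k
      simp only [if_true]; linarith
    · rw [Finset.sum_eq_zero fun k _ => if_neg fun e => hi ⟨k, e⟩]
      norm_num
  · simp only [add_smul, one_smul, Finset.sum_add_distrib, Finset.sum_smul, ite_smul, zero_smul]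
    rw [Finset.sum_comm]
    have h1 : ∀ k, ∑ i ∈ F, (if a k = i then b.repr (r F) k • x i else 0) =
        b.repr (r F) k • (b k : E) := fun k => by
      rw [Finset.sum_ite_eq, if_pos (haF (Finset.mem_image_of_mem a (Finset.mem_univ k))), hb]
    simp only [h1]
    have h2 : (r F : E) = ∑ k, b.repr (r F) k • (b k : E) := by
      conv_lhs => rw [← b.sum_repr (r F)]
      simp only [Submodule.coe_sum, Submodule.coe_smul]
    rw [← h2]
    simp [r]

end Cone

/-! ### Restricting a strategy to invariant subspaces. -/

section Restrict

variable {n c : ℕ} {H : Type u} [NormedAddCommGroup H] [InnerProductSpace ℂ H]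

/-- The compression of a family of block matrices to a common invariant subspace. -/
def restrictBlocks (P : Fin c → Matrix (Fin n) (Fin n) (H →L[ℂ] H)) (V : Submodule ℂ H)
    (hV : ∀ a i j, ∀ x ∈ V, P a i j x ∈ V) : Fin c → Matrix (Fin n) (Fin n) (V →L[ℂ] V) :=
  fun a i j => (P a i j).restrict (hV a i j)

theorem coe_restrictBlocks (P : Fin c → Matrix (Fin n) (Fin n) (H →L[ℂ] H)) (V : Submodule ℂ H)
    (hV : ∀ a i j, ∀ x ∈ V, P a i j x ∈ V) (a : Fin c) (i j : Fin n) (x : V) :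
    (restrictBlocks P V hV a i j x : H) = P a i j x := rfl

theorem IsPOVM.restrict {P : Fin c → Matrix (Fin n) (Fin n) (H →L[ℂ] H)} (hP : IsPOVM P)
    (V : Submodule ℂ H) (hV : ∀ a i j, ∀ x ∈ V, P a i j x ∈ V) :
    IsPOVM (restrictBlocks P V hV) where
  pos a := by
    rw [ContinuousLinearMap.isPositive_iff_complex]
    intro x
    let y : PiLp 2 (fun _ : Fin n => H) := WithLp.toLp 2 fun i => (x i : H)
    have h : ⟪blockOp (restrictBlocks P V hV a) x, x⟫_ℂ = ⟪blockOp (P a) y, y⟫_ℂ := by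
      simp only [PiLp.inner_apply, blockOp_apply, Submodule.coe_inner, Submodule.coe_sum,
        coe_restrictBlocks, y]
    rw [h]
    exact (ContinuousLinearMap.isPositive_iff_complex _).1 (hP.pos a) y
  sum_eq_one := by
    ext i j x
    have := congrArg (fun S : H →L[ℂ] H => S x) (hP.sum_apply i j)
    rw [Matrix.sum_apply, Matrix.one_apply]
    simp only [_root_.sum_apply, Submodule.coe_sum, coe_restrictBlocks] at this ⊢
    rw [this]
    split_ifs <;> simp

variable {K : Type u} [NormedAddCommGroup K] [InnerProductSpace ℂ K]

theorem inner_coe_opTensor_coe (S : H →L[ℂ] H) (T : K →L[ℂ] K) (t : H ⊗[ℂ] K) :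
    ⟪(t : HTensor H K), opTensor S T (t : HTensor H K)⟫_ℂ = ⟪t, TensorProduct.mapL S T t⟫_ℂ := by
  rw [opTensor, ContinuousLinearMap.completion_apply_coe, UniformSpace.Completion.inner_coe]

theorem mapL_mapIncl (P : Fin c → Matrix (Fin n) (Fin n) (H →L[ℂ] H))
    (Q : Fin c → Matrix (Fin n) (Fin n) (K →L[ℂ] K)) (V : Submodule ℂ H) (W : Submodule ℂ K)
    (hV : ∀ a i j, ∀ x ∈ V, P a i j x ∈ V) (hW : ∀ a i j, ∀ x ∈ W, Q a i j x ∈ W)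
    (a b : Fin c) (i j k l : Fin n) (t : V ⊗[ℂ] W) :
    TensorProduct.mapL (P a i j) (Q b k l) (TensorProduct.mapIncl V W t) =
      TensorProduct.mapIncl V W (TensorProduct.mapL (restrictBlocks P V hV a i j)
        (restrictBlocks Q W hW b k l) t) := by
  induction t with
  | zero => simp
  | tmul x y => simp [TensorProduct.mapIncl, coe_restrictBlocks]
  | add t s ht hs => rw [map_add, map_add, ht, hs, map_add, map_add]

theorem inner_opTensor_mapIncl (P : Fin c → Matrix (Fin n) (Fin n) (H →L[ℂ] H))
    (Q : Fin c → Matrix (Fin n) (Fin n) (K →L[ℂ] K)) (V : Submodule ℂ H) (W : Submodule ℂ K)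
    (hV : ∀ a i j, ∀ x ∈ V, P a i j x ∈ V) (hW : ∀ a i j, ∀ x ∈ W, Q a i j x ∈ W)
    (a b : Fin c) (i j k l : Fin n) (t : V ⊗[ℂ] W) (ξ : HTensor H K)
    (hξ : ξ = (TensorProduct.mapIncl V W t : H ⊗[ℂ] K)) :
    ⟪(t : HTensor V W), opTensor (restrictBlocks P V hV a i j)
      (restrictBlocks Q W hW b k l) (t : HTensor V W)⟫_ℂ =
        ⟪ξ, opTensor (P a i j) (Q b k l) ξ⟫_ℂ := by
  rw [hξ, inner_coe_opTensor_coe (P a i j), mapL_mapIncl P Q V W hV hW,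
    TensorProduct.inner_mapIncl_mapIncl]
  exact inner_coe_opTensor_coe _ _ t

/-- A strategy whose state lies in `V ⊗ W` for finite-dimensional invariant subspaces `V`, `W` has a
quantum correlation. -/
theorem mem_Qq_of_invariant {P : Fin c → Matrix (Fin n) (Fin n) (H →L[ℂ] H)}
    {Q : Fin c → Matrix (Fin n) (Fin n) (K →L[ℂ] K)} (hP : IsPOVM P) (hQ : IsPOVM Q)
    (V : Submodule ℂ H) (W : Submodule ℂ K) [FiniteDimensional ℂ V] [FiniteDimensional ℂ W]
    (hV : ∀ a i j, ∀ x ∈ V, P a i j x ∈ V) (hW : ∀ a i j, ∀ x ∈ W, Q a i j x ∈ W)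
    (t : V ⊗[ℂ] W) (ξ : HTensor H K) (hξ : ξ = (TensorProduct.mapIncl V W t : H ⊗[ℂ] K))
    (hn : ‖ξ‖ = 1) :
    (fun a b ij kl => ⟪ξ, opTensor (P a ij.1 ij.2) (Q b kl.1 kl.2) ξ⟫_ℂ : Corr n c) ∈
      Qq.{u} n c := by
  have hnorm : ‖(t : HTensor V W)‖ = 1 := by
    rw [← hn, hξ, UniformSpace.Completion.norm_coe, UniformSpace.Completion.norm_coe]
    exact (TensorProduct.norm_map V.subtypeₗᵢ W.subtypeₗᵢ t).symm
  let S : Strategy n c V W :=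
    ⟨restrictBlocks P V hV, restrictBlocks Q W hW, t, hP.restrict V hV, hQ.restrict W hW, hnorm⟩
  refine ⟨V, W, _, _, inferInstance, _, _, inferInstance, S, ?_⟩
  funext a b ij kl
  exact inner_opTensor_mapIncl P Q V W hV hW a b ij.1 ij.2 kl.1 kl.2 t ξ hξ

/-- The norm of the state can be read off from the correlation as soon as there is an index `i`. -/
theorem sum_inner_opTensor {K : Type v} [NormedAddCommGroup K] [InnerProductSpace ℂ K]
    {P : Fin c → Matrix (Fin n) (Fin n) (H →L[ℂ] H)}
    {Q : Fin c → Matrix (Fin n) (Fin n) (K →L[ℂ] K)} (hP : IsPOVM P) (hQ : IsPOVM Q)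
    (ξ : HTensor H K) (i : Fin n) :
    ∑ a, ∑ b, ⟪ξ, opTensor (P a i i) (Q b i i) ξ⟫_ℂ = ⟪ξ, ξ⟫_ℂ := by
  simp only [← inner_sum, ← _root_.sum_apply, ← opTensor_sum_right, ← opTensor_sum_left,
    hP.sum_apply, hQ.sum_apply, if_true, opTensor_one]
  rfl

/-- With `n = 0` the correlation is empty and does not determine the norm of the state, so the main
argument needs this case apart. -/
theorem zero_inputs_mem_Qq (X : Corr 0 c) : X ∈ Qq.{u} 0 c := by
  let E := EuclideanSpace ℂ PUnit.{u + 1}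
  let e : E := EuclideanSpace.single PUnit.unit 1
  have hp : IsPOVM (fun _ : Fin c => (0 : Matrix (Fin 0) (Fin 0) (E →L[ℂ] E))) :=
    ⟨fun a => by
      rw [show blockOp (0 : Matrix (Fin 0) (Fin 0) (E →L[ℂ] E)) = 0 from
        ContinuousLinearMap.ext fun x => Subsingleton.elim _ _]
      exact ContinuousLinearMap.isPositive_zero, Subsingleton.elim _ _⟩
  refine ⟨E, E, inferInstance, inferInstance, inferInstance, inferInstance, inferInstance,
    inferInstance, ⟨_, _, htmul e e, hp, hp, ?_⟩, ?_⟩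
  · have he : ‖e‖ = 1 := (PiLp.norm_single _ _ _ _).trans norm_one
    rw [htmul_apply, UniformSpace.Completion.norm_coe, TensorProduct.norm_tmul, he, one_mul]
  · funext a b ij
    exact ij.1.elim0

end Restrict

theorem Qq_subset_Qqs (n c : ℕ) : Qq.{u} n c ⊆ Qqs.{u} n c := by
  rintro X ⟨HA, HB, i₁, i₂, i₃, i₄, i₅, i₆, S, hS⟩
  exact ⟨HA, HB, i₁, i₂, FiniteDimensional.complete ℂ HA, i₄, i₅, FiniteDimensional.complete ℂ HB,
    S, hS⟩

/-! ### Spectral decomposition and reduction to finite dimension. -/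

section Main

variable {n c : ℕ} {H K : Type u} [NormedAddCommGroup H] [InnerProductSpace ℂ H]
  [NormedAddCommGroup K] [InnerProductSpace ℂ K] [CompleteSpace H] [CompleteSpace K]

theorem Strategy.gram_comm (S : Strategy n c H K) (hS : S.correlation.IsSynchronous)
    (a : Fin c) (i j : Fin n) (x : H) : gram S.χ (S.P a i j x) = S.P a i j (gram S.χ x) := by
  refine gram_apply_comm (S.apply_contract hS a i j) (fun x => ?_) x
  rw [adjoint_block_of_isPositive (S.povm_P.pos a), adjoint_block_of_isPositive (S.povm_Q.pos a)]
  exact S.apply_contract hS a j i x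

theorem Strategy.correlation_mem_Qq (S : Strategy n c H K)
    (hS : S.correlation.IsSynchronous) : S.correlation ∈ Qq.{u} n c := by
  classical
  rcases n.eq_zero_or_pos with rfl | hn
  · exact zero_inputs_mem_Qq _
  let V (μ : ℂ) : Submodule ℂ H := Module.End.eigenspace (gram S.χ : H →ₗ[ℂ] H) μ
  have hmem {μ : ℂ} {x : H} : x ∈ V μ ↔ gram S.χ x = μ • x := Module.End.mem_eigenspace_iff
  have hcpl (μ : ℂ) : CompleteSpace (V μ) := by
    have hcl : IsClosed (V μ : Set H) := by
      have : (V μ : Set H) = {x | gram S.χ x = μ • x} := Set.ext fun x => hmem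
      rw [this]
      exact isClosed_eq (by fun_prop) (by fun_prop)
    exact hcl.completeSpace_coe
  have hcompact := isCompactOperator_gram S.χ
  have hsymm := isSymmetric_gram S.χ
  have hV : OrthogonalFamily ℂ (fun μ => V μ) fun μ => (V μ).subtypeₗᵢ :=
    hsymm.orthogonalFamily_eigenspaces
  have hd : (⨆ μ, V μ)ᗮ = ⊥ :=
    ContinuousLinearMap.orthogonalComplement_iSup_eigenspaces_eq_bot hcompact hsymm
  have hfin (μ : ℂ) (hμ : μ ≠ 0) : FiniteDimensional ℂ (V μ) :=
    ContinuousLinearMap.finite_dimensional_eigenspace hcompact μ hμ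
  have hinv (μ : ℂ) (a i j) (x : H) (hx : x ∈ V μ) : S.P a i j x ∈ V μ := by
    rw [hmem] at hx ⊢
    rw [S.gram_comm hS, hx, map_smul]
  have hcomm (a i j) (μ : ℂ) (x : H) :
      (V μ).starProjection (S.P a i j x) = S.P a i j ((V μ).starProjection x) := by
    refine starProjection_apply_comm (S' := S.P a j i) (fun x y => ?_) (hinv μ a i j)
      (hinv μ a j i) x
    rw [← adjoint_block_of_isPositive (S.povm_P.pos a) i j,
      ContinuousLinearMap.adjoint_inner_right]
  let χ (μ : ℂ) : HTensor H K := opTensor (V μ).starProjection 1 S.χ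
  have hχ : HasSum χ S.χ := hasSum_opTensor_starProjection hV hd S.χ
  have hχ0 : χ 0 = 0 := by
    refine HTensor.ext_inner fun x y => ?_
    rw [inner_zero_right, ← inner_contract, contract_opTensor,
      (isSelfAdjoint_starProjection (V 0)).adjoint_eq, contract_eq_zero_of_gram_eq_zero, map_zero,
      inner_zero_right]
    have := hmem.1 ((V 0).starProjection_apply_mem x)
    rwa [zero_smul] at this
  -- Keeping `S.χ` on the left makes this linear in `χ μ`, hence summable; since the projections
  -- commute with `P`, it is also the correlation of `χ μ` with itself.
  let X (μ : ℂ) : Corr n c := fun a b ij kl =>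
    ⟪S.χ, opTensor (S.P a ij.1 ij.2) (S.Q b kl.1 kl.2) (χ μ)⟫_ℂ
  have hX : HasSum X S.correlation := by
    simp only [Pi.hasSum]
    intro a b ij kl
    exact (innerSL ℂ S.χ ∘L opTensor (S.P a ij.1 ij.2) (S.Q b kl.1 kl.2)).hasSum hχ
  obtain ⟨F, d, hd0, hsum⟩ := exists_finset_sum_smul_eq_of_hasSum hX
  let ξ : HTensor H K := ∑ μ ∈ F, ((Real.sqrt (d μ) : ℝ) : ℂ) • χ μ
  have hcorr : (fun a b ij kl => ⟪ξ, opTensor (S.P a ij.1 ij.2) (S.Q b kl.1 kl.2) ξ⟫_ℂ :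
      Corr n c) = S.correlation := by
    rw [hsum]
    funext a b ij kl
    simp only [Finset.sum_apply, Pi.smul_apply, ξ, map_sum, map_smul, sum_inner, inner_sum,
      inner_smul_left, inner_smul_right, Complex.conj_ofReal]
    refine Finset.sum_congr rfl fun μ hμ => ?_
    have h (ν : ℂ) := inner_opTensor_starProjection hV (hcomm a ij.1 ij.2) (S.Q b kl.1 kl.2) S.χ ν μ
    rw [Finset.sum_eq_single μ (fun ν _ hν => by
      rw [show ⟪χ ν, _⟫_ℂ = _ from h ν, if_neg hν]; simp) (fun h => absurd hμ h)]
    rw [show ⟪χ μ, _⟫_ℂ = _ from h μ, if_pos rfl, ← mul_assoc, ← Complex.ofReal_mul,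
      Real.mul_self_sqrt (hd0 μ), Complex.real_smul]
  -- Removing `0` ensures finite dimension and loses nothing, as `χ 0 = 0`.
  let U : Submodule ℂ H := (F.erase 0).sup V
  have hUfin : FiniteDimensional ℂ U := by
    have (μ : ℂ) (hμ : μ ∈ F.erase 0) : (V μ).FG :=
      Module.Finite.iff_fg.1 (hfin μ (Finset.ne_of_mem_erase hμ))
    exact Module.Finite.iff_fg.2 (Submodule.fg_finset_sup _ _ this)
  have hU (a i j) (x : H) (hx : x ∈ U) : S.P a i j x ∈ U := by
    have : U ≤ U.comap (S.P a i j : H →ₗ[ℂ] H) :=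
      Finset.sup_le fun μ hμ x hx => Finset.le_sup (f := V) hμ (hinv μ a i j x hx)
    exact this hx
  let W : Submodule ℂ K := U.map (contract S.χ : H →ₛₗ[starRingEnd ℂ] K)
  have hWfin : FiniteDimensional ℂ W := by
    exact Module.Finite.iff_fg.2 ((Module.Finite.iff_fg.1 hUfin).map _)
  have hW (a i j) (y : K) (hy : y ∈ W) : S.Q a i j y ∈ W := by
    obtain ⟨x, hx, rfl⟩ := hy
    exact ⟨S.P a i j x, hU a i j x hx, (S.apply_contract hS a i j x).symm⟩
  let ι : U ⊗[ℂ] W →ₗ[ℂ] HTensor H K :=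
    (UniformSpace.Completion.toComplL : H ⊗[ℂ] K →L[ℂ] HTensor H K).toLinearMap ∘ₗ
      TensorProduct.mapIncl U W
  have hξ : ξ ∈ LinearMap.range ι := by
    refine Submodule.sum_mem _ fun μ hμ => Submodule.smul_mem _ _ ?_
    by_cases h0 : μ = 0
    · subst h0; rw [hχ0]; exact zero_mem _
    have := hfin μ h0
    change opTensor (V μ).starProjection 1 S.χ ∈ _
    rw [opTensor_starProjection_eq_sum]
    refine Submodule.sum_mem _ fun i _ => ?_
    have hv : (stdOrthonormalBasis ℂ (V μ) i : H) ∈ U :=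
      Finset.le_sup (f := V) (Finset.mem_erase.2 ⟨h0, hμ⟩) (stdOrthonormalBasis ℂ (V μ) i).2
    exact ⟨⟨_, hv⟩ ⊗ₜ ⟨_, Submodule.mem_map_of_mem hv⟩, rfl⟩
  obtain ⟨t, ht⟩ := hξ
  -- No normalization is needed: `ξ` and `S.χ` have the same correlation, which determines the norm.
  have hnorm : ‖ξ‖ = 1 := by
    have h : ⟪ξ, ξ⟫_ℂ = ⟪S.χ, S.χ⟫_ℂ := by
      rw [← sum_inner_opTensor S.povm_P S.povm_Q ξ ⟨0, hn⟩,
        ← sum_inner_opTensor S.povm_P S.povm_Q S.χ ⟨0, hn⟩]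
      exact Finset.sum_congr rfl fun a _ => Finset.sum_congr rfl fun b _ =>
        congrFun (congrFun (congrFun (congrFun hcorr a) b) (⟨0, hn⟩, ⟨0, hn⟩)) (⟨0, hn⟩, ⟨0, hn⟩)
    rw [inner_self_eq_norm_sq_to_K, inner_self_eq_norm_sq_to_K, S.norm_χ] at h
    have h2 : ‖ξ‖ ^ 2 = 1 := by
      have := congrArg Complex.re h
      simpa [← Complex.ofReal_pow] using this
    exact (pow_eq_one_iff_of_nonneg (norm_nonneg ξ) two_ne_zero).1 h2
  rw [← hcorr]
  exact mem_Qq_of_invariant S.povm_P S.povm_Q U W hU hW t ξ ht.symm hnorm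

end Main

end

end QInput


theorem mainTheorem10 (n c : ℕ) : QInput.QqsSync.{u} n c = QInput.QqSync.{u} n c := by
  refine Set.Subset.antisymm ?_ fun X hX => ⟨QInput.Qq_subset_Qqs n c hX.1, hX.2⟩
  rintro X ⟨⟨HA, HB, i₁, i₂, i₃, i₄, i₅, i₆, S, rfl⟩, hS⟩
  exact ⟨S.correlation_mem_Qq hS, hS⟩
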